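/- Let $s>2$ be an integer, let $p_0,\dots,p_{s-1}>0$ be real numbers with $p_0+\dots+p_{s-1}=1$, and put $\beta_k=\sum_{i<k}p_i$ for $0\le k\le s-1$ (so $\beta_0=0$). For a sequence of digits $d_1,d_2,\dots\in\{0,\dots,s-1\}$ let $$\Delta^P_{d_1d_2\dots}=\beta_{d_1}+\sum_{n=2}^{\infty}\Big(\beta_{d_n}\prod_{j=1}^{n-1}p_{d_j}\Big)\in[0,1].$$ Fix $u\in\{0,\dots,s-1\}$, let $A_0=\{1,\dots,s-1\}$, and let $$\mathbb S_{(P_s,u)}=\Big\{\Delta^{P}_{\underbrace{u\dots u}_{\alpha_1-1}\alpha_1\underbrace{u\dots u}_{\alpha_2-1}\alpha_2\dots\underbrace{u\dots u}_{\alpha_n-1}\alpha_n\dots}\;:\;\alpha_n\in A_0\setminus\{u\}\text{ for all }n\ge 1\Big\}.$$ Then: (1) $\mathbb S_{(P_s,u)}$ is a self-similar set with ratios $p_ip_u^{i-1}$, $i\in A_0\setminus\{u\}$: it is nonempty and compact, all these ratios lie in $(0,1)$, and there are maps $f_i:\mathbb R\to\mathbb R$ with $|f_i(x)-f_i(y)|=p_ip_u^{i-1}|x-y|$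 for all $x,y\in\mathbb R$ such that $\mathbb S_{(P_s,u)}$ is the union of the pairwise disjoint sets $f_i(\mathbb S_{(P_s,u)})$, $i\in A_0\setminus\{u\}$. (2) If $(s,u)\notin\{(3,1),(3,2)\}$, then $\mathbb S_{(P_s,u)}$ is a fractal, i.e. its Hausdorff dimension exceeds its topological dimension: it is totally disconnected and has positive Hausdorff dimension. (3) The Hausdorff dimension $\alpha_0$ of $\mathbb S_{(P_s,u)}$ is finite and is the unique real root of the equation $$\sum_{i\in A_0\setminus\{u\}}\left(p_ip_u^{i-1}\right)^{\alpha_0}=1.$$ -/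

import Mathlib

/-- The partial sums `β_k = p_0 + ⋯ + p_{k-1}` of the weights (so `β_0 = 0`). -/
noncomputable def pBeta {s : ℕ} (p : Fin s → ℝ) (k : Fin s) : ℝ :=
  ∑ i ∈ Finset.Iio k, p i

/-- `IsPRepresentation p d x` says that `d 0, d 1, d 2, …` is a P-representation of `x`, i.e.
`x = β_{d 0} + ∑_{n ≥ 1} β_{d n} p_{d 0} ⋯ p_{d (n-1)}`, the series being convergent
(digit positions are counted from `0`). -/
def IsPRepresentation {s : ℕ} (p : Fin s → ℝ) (d : ℕ → Fin s) (x : ℝ) : Prop :=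
  HasSum (fun n : ℕ => pBeta p (d n) * ∏ j ∈ Finset.range n, p (d j)) x

/-- The set `A_0 ∖ {u}` of digits different from `0` and from `u`. -/
def admissibleDigits {s : ℕ} (u : Fin s) : Finset (Fin s) :=
  Finset.univ.filter (fun i => (i : ℕ) ≠ 0 ∧ i ≠ u)

/-- The position (counted from `0`) at which the `n`-th block starts, when the `k`-th block has
length `a k`. -/
def blockStart {s : ℕ} (a : ℕ → Fin s) (n : ℕ) : ℕ :=
  ∑ k ∈ Finset.range n, (a k : ℕ)

/-- `d` is the concatenation of the blocks `u … u (a n)`, `n = 0, 1, 2, …`, the `n`-th block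
consisting of `a n - 1` copies of `u` followed by the digit `a n`. If all `a n` are nonzero, this
determines every digit of `d`. -/
def IsBlockSequence {s : ℕ} (u : Fin s) (a d : ℕ → Fin s) : Prop :=
  ∀ n : ℕ, (∀ j : ℕ, j < (a n : ℕ) - 1 → d (blockStart a n + j) = u) ∧
    d (blockStart a n + ((a n : ℕ) - 1)) = a n

/-- The set `𝕊_(P_s,u)`. -/
def setS {s : ℕ} (p : Fin s → ℝ) (u : Fin s) : Set ℝ :=
  {x | ∃ a d : ℕ → Fin s, (∀ n, a n ∈ admissibleDigits u) ∧ IsBlockSequence u a d ∧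
    IsPRepresentation p d x}

/-- `S` is a self-similar set with similarity ratios `r i`, `i : ι` (`ι` finite): it is nonempty
and compact, and it is the disjoint union of its images under contracting similarities with
these ratios. -/
def IsSelfSimilarSet {X ι : Type*} [MetricSpace X] [Finite ι] (r : ι → ℝ) (S : Set X) : Prop :=
  S.Nonempty ∧ IsCompact S ∧ (∀ i, 0 < r i ∧ r i < 1) ∧
    ∃ f : ι → X → X,
      (∀ i x y, dist (f i x) (f i y) = r i * dist x y) ∧
      S = ⋃ i, f i '' S ∧
      Pairwise (fun i j => Disjoint (f i '' S) (f j '' S))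

/-- A set of real numbers is a fractal if its Hausdorff dimension exceeds its topological
dimension. A subset of the line has topological dimension at most `0` exactly when it is totally
disconnected; otherwise it contains an interval and both dimensions are `1`. -/
def IsFractalSubset (S : Set ℝ) : Prop :=
  IsTotallyDisconnected S ∧ 0 < dimH S

/-! Write g_k(x) = β_k + p_k x. Reading a sequence block by block shows that the set is the
attractor of the affine maps f_i = g_u^(i-1) ∘ g_i, with ratios r_i = p_i p_u^(i-1): it is the range
of the continuous address map `digitSeries` (`setS_eq_range`), hence compact. Its pieces are
disjoint. Every block ends in a nonzero digit, so all points lie in (0, 1], where different g_k have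
disjoint images; for i < j, cancelling i - 1 copies of g_u leaves digit i against digit u ≠ i
(`blockMap_ne_blockMap_of_lt`). Let ∑ r_i^α = 1. Cylinder covers give dimension at most α
(`dimH_range_digitSeries_le`). Conversely, sending each point to the point of [0, 1] with the same
address and weights r_i^α is an α-Hölder surjection, so the dimension is at least α
(`le_dimH_range_digitSeries`). Since digit 0 is never used, ∑ r_i < 1, so α < 1 and the set contains
no interval; two admissible digits force α > 0. -/

/-! ### Address maps of affine iterated function systems on the line. -/

section DigitSeries

open Set Filter Topology MeasureTheory
open scoped NNReal ENNReal

variable {ι : Type*}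

/-- The point `c_{a 0} + r_{a 0} (c_{a 1} + r_{a 1} (c_{a 2} + ⋯))` with address `a` in the iterated
function system `x ↦ c i + r i * x`. -/
noncomputable def digitSeries (c r : ι → ℝ) (a : ℕ → ι) : ℝ :=
  ∑' n, c (a n) * ∏ j ∈ Finset.range n, r (a j)

theorem exists_uniform_lt_one [Finite ι] {r : ι → ℝ} (hr0 : ∀ i, 0 ≤ r i) (hr1 : ∀ i, r i < 1) :
    ∃ ρ : ℝ, 0 ≤ ρ ∧ ρ < 1 ∧ ∀ i, r i ≤ ρ := by
  cases isEmpty_or_nonempty ι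
  · exact ⟨0, le_rfl, one_pos, fun i => isEmptyElim i⟩
  · obtain ⟨i, hi⟩ := Finite.exists_max r
    exact ⟨r i, hr0 i, hr1 i, hi⟩

theorem exists_uniform_abs_le [Finite ι] (c : ι → ℝ) : ∃ M : ℝ, 0 ≤ M ∧ ∀ i, |c i| ≤ M := by
  cases isEmpty_or_nonempty ι
  · exact ⟨0, le_rfl, fun i => isEmptyElim i⟩
  · obtain ⟨i, hi⟩ := Finite.exists_max fun i => |c i|
    exact ⟨|c i|, abs_nonneg _, hi⟩

theorem prod_range_le_pow {r : ι → ℝ} {ρ : ℝ} (hr0 : ∀ i, 0 ≤ r i) (hρ : ∀ i, r i ≤ ρ)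
    (a : ℕ → ι) (n : ℕ) : ∏ j ∈ Finset.range n, r (a j) ≤ ρ ^ n := by
  simpa using Finset.prod_le_prod (s := Finset.range n) (fun j _ => hr0 (a j)) fun j _ => hρ (a j)

theorem prod_range_shift (r : ι → ℝ) (a : ℕ → ι) (n : ℕ) :
    ∏ j ∈ Finset.range (n + 1), r (a j)
      = r (a 0) * ∏ j ∈ Finset.range n, r (a (j + 1)) := by
  rw [Finset.prod_range_succ', mul_comm]

theorem exists_summable_bound [Finite ι] (c : ι → ℝ) {r : ι → ℝ} (hr0 : ∀ i, 0 ≤ r i)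
    (hr1 : ∀ i, r i < 1) :
    ∃ v : ℕ → ℝ, Summable v ∧
      ∀ n (a : ℕ → ι), ‖c (a n) * ∏ j ∈ Finset.range n, r (a j)‖ ≤ v n := by
  obtain ⟨ρ, hρ0, hρ1, hρ⟩ := exists_uniform_lt_one hr0 hr1
  obtain ⟨M, hM0, hM⟩ := exists_uniform_abs_le c
  refine ⟨fun n => M * ρ ^ n, (summable_geometric_of_lt_one hρ0 hρ1).mul_left M, fun n a => ?_⟩
  rw [norm_mul, Real.norm_eq_abs, Real.norm_of_nonneg (Finset.prod_nonneg fun j _ => hr0 _)]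
  exact mul_le_mul (hM _) (prod_range_le_pow hr0 hρ a n)
    (Finset.prod_nonneg fun j _ => hr0 _) hM0

theorem summable_digitSeries [Finite ι] (c : ι → ℝ) {r : ι → ℝ} (hr0 : ∀ i, 0 ≤ r i)
    (hr1 : ∀ i, r i < 1) (a : ℕ → ι) :
    Summable fun n => c (a n) * ∏ j ∈ Finset.range n, r (a j) := by
  obtain ⟨v, hv, h⟩ := exists_summable_bound c hr0 hr1
  exact hv.of_norm_bounded fun n => h n a

theorem digitSeries_eq [Finite ι] (c : ι → ℝ) {r : ι → ℝ} (hr0 : ∀ i, 0 ≤ r i)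
    (hr1 : ∀ i, r i < 1) (a : ℕ → ι) :
    digitSeries c r a = c (a 0) + r (a 0) * digitSeries c r fun n => a (n + 1) := by
  unfold digitSeries
  rw [(summable_digitSeries c hr0 hr1 a).tsum_eq_zero_add, ← tsum_mul_left]
  congr 1
  · simp
  · refine tsum_congr fun n => ?_
    rw [prod_range_shift]
    ring

theorem continuous_digitSeries [Finite ι] [TopologicalSpace ι] [DiscreteTopology ι] (c : ι → ℝ)
    {r : ι → ℝ} (hr0 : ∀ i, 0 ≤ r i) (hr1 : ∀ i, r i < 1) : Continuous (digitSeries c r) := by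
  obtain ⟨v, hv, h⟩ := exists_summable_bound c hr0 hr1
  refine continuous_tsum (fun n => ?_) hv h
  refine ((continuous_of_discreteTopology (f := c)).comp (continuous_apply n)).mul ?_
  exact continuous_finsetProd _ fun j _ =>
    (continuous_of_discreteTopology (f := r)).comp (continuous_apply j)

theorem exists_abs_digitSeries_le [Finite ι] (c : ι → ℝ) {r : ι → ℝ} (hr0 : ∀ i, 0 ≤ r i)
    (hr1 : ∀ i, r i < 1) : ∃ D : ℝ, 0 ≤ D ∧ ∀ a, |digitSeries c r a| ≤ D := by
  obtain ⟨v, hv, h⟩ := exists_summable_bound c hr0 hr1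
  cases isEmpty_or_nonempty (ℕ → ι) with
  | inl _ => exact ⟨0, le_rfl, fun a => isEmptyElim a⟩
  | inr hne =>
    obtain ⟨a⟩ := hne
    exact ⟨∑' n, v n, tsum_nonneg fun n => (norm_nonneg _).trans (h n a),
      fun b => tsum_of_norm_bounded hv.hasSum fun n => h n b⟩

/-- A bounded solution of the recursion of `digitSeries` is given by `digitSeries`. -/
theorem eq_digitSeries_of_recursion [Finite ι] (c : ι → ℝ) {r : ι → ℝ} (hr0 : ∀ i, 0 ≤ r i)
    (hr1 : ∀ i, r i < 1) (a : ℕ → ι) {y : ℕ → ℝ} {D : ℝ} (hD : ∀ n, |y n| ≤ D)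
    (hy : ∀ n, y n = c (a n) + r (a n) * y (n + 1)) : y 0 = digitSeries c r a := by
  obtain ⟨ρ, hρ0, hρ1, hρ⟩ := exists_uniform_lt_one hr0 hr1
  have key : ∀ N, ∑ n ∈ Finset.range N, c (a n) * ∏ j ∈ Finset.range n, r (a j)
      = y 0 - (∏ j ∈ Finset.range N, r (a j)) * y N := by
    intro N
    induction N with
    | zero => simp
    | succ N ih =>
      rw [Finset.sum_range_succ, ih, Finset.prod_range_succ]
      linear_combination (-∏ j ∈ Finset.range N, r (a j)) * hy N
  have hlim : Tendsto (fun N => (∏ j ∈ Finset.range N, r (a j)) * y N) atTop (𝓝 0) := by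
    refine squeeze_zero_norm (a := fun N => ρ ^ N * D) (fun N => ?_) ?_
    · rw [norm_mul, Real.norm_of_nonneg (Finset.prod_nonneg fun j _ => hr0 _)]
      exact mul_le_mul (prod_range_le_pow hr0 hρ a N) (hD N) (norm_nonneg _) (pow_nonneg hρ0 _)
    · simpa using (tendsto_pow_atTop_nhds_zero_of_lt_one hρ0 hρ1).mul_const D
  have h1 := (summable_digitSeries c hr0 hr1 a).hasSum.tendsto_sum_nat
  have h2 : Tendsto (fun N => ∑ n ∈ Finset.range N, c (a n) * ∏ j ∈ Finset.range n, r (a j))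
      atTop (𝓝 (y 0)) := by
    simpa [key] using hlim.const_sub (y 0)
  exact tendsto_nhds_unique h2 h1

theorem digitSeries_mem_Icc [Finite ι] {c r : ι → ℝ} (hr0 : ∀ i, 0 ≤ r i) (hr1 : ∀ i, r i < 1)
    (hc : ∀ i, 0 ≤ c i) (hcr : ∀ i, c i + r i ≤ 1) (a : ℕ → ι) :
    digitSeries c r a ∈ Icc (0 : ℝ) 1 := by
  have hp : ∀ n, 0 ≤ ∏ j ∈ Finset.range n, r (a j) :=
    fun n => Finset.prod_nonneg fun j _ => hr0 _
  refine ⟨tsum_nonneg fun n => mul_nonneg (hc _) (hp n), ?_⟩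
  refine (summable_digitSeries c hr0 hr1 a).tsum_le_of_sum_range_le fun N => ?_
  -- The product is the room left for the remaining terms; keeping it makes the induction close.
  suffices h : ∑ n ∈ Finset.range N, c (a n) * ∏ j ∈ Finset.range n, r (a j)
      ≤ 1 - ∏ j ∈ Finset.range N, r (a j) from h.trans (sub_le_self _ (hp N))
  induction N with
  | zero => simp
  | succ N ih =>
    rw [Finset.sum_range_succ, Finset.prod_range_succ]
    nlinarith [hp N, hcr (a N)]

/-- Gives both the diameters of cylinders and the comparison of two systems at the first
disagreement of two addresses. -/
theorem digitSeries_sub_of_agree [Finite ι] (c : ι → ℝ) {r : ι → ℝ} (hr0 : ∀ i, 0 ≤ r i)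
    (hr1 : ∀ i, r i < 1) (n : ℕ) (a b : ℕ → ι) (h : ∀ j < n, a j = b j) :
    digitSeries c r a - digitSeries c r b = (∏ j ∈ Finset.range n, r (a j)) *
      (digitSeries c r (fun k => a (k + n)) - digitSeries c r fun k => b (k + n)) := by
  induction n generalizing a b with
  | zero => simp
  | succ n ih =>
    rw [digitSeries_eq c hr0 hr1 a, digitSeries_eq c hr0 hr1 b, prod_range_shift,
      ← h 0 n.succ_pos, add_sub_add_left_eq_sub, ← mul_sub,
      ih (fun k => a (k + 1)) (fun k => b (k + 1)) fun j hj => h (j + 1) (by omega), mul_assoc]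
    rfl

theorem range_digitSeries_eq_iUnion [Finite ι] (c : ι → ℝ) {r : ι → ℝ} (hr0 : ∀ i, 0 ≤ r i)
    (hr1 : ∀ i, r i < 1) :
    range (digitSeries c r) = ⋃ i, (fun x => c i + r i * x) '' range (digitSeries c r) := by
  ext x
  simp only [mem_iUnion, mem_image, mem_range, exists_exists_eq_and]
  constructor
  · rintro ⟨a, rfl⟩
    exact ⟨a 0, fun n => a (n + 1), (digitSeries_eq c hr0 hr1 a).symm⟩
  · rintro ⟨i, a, rfl⟩
    exact ⟨fun n => Nat.casesOn n i a, digitSeries_eq c hr0 hr1 _⟩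

/-! ### Upper bound for the dimension. -/

/-- The Moran cover bounds the dimension from above by the similarity dimension. -/
theorem dimH_range_digitSeries_le [Fintype ι] (c : ι → ℝ) {r : ι → ℝ} (hr0 : ∀ i, 0 ≤ r i)
    (hr1 : ∀ i, r i < 1) (α : ℝ≥0) (hα : ∑ i, r i ^ (α : ℝ) = 1) :
    dimH (range (digitSeries c r)) ≤ α := by
  obtain ⟨ρ, hρ0, hρ1, hρ⟩ := exists_uniform_lt_one hr0 hr1
  obtain ⟨D, hD0, hD⟩ := exists_abs_digitSeries_le c hr0 hr1
  let t : (n : ℕ) → (Fin n → ι) → Set ℝ :=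
    fun n w => digitSeries c r '' {a | ∀ j : Fin n, a j = w j}
  have hdiam : ∀ n w, Metric.ediam (t n w) ≤ ENNReal.ofReal ((∏ j, r (w j)) * (2 * D)) := by
    intro n w
    refine Metric.ediam_le ?_
    rintro _ ⟨a, ha, rfl⟩ _ ⟨b, hb, rfl⟩
    rw [edist_dist]
    refine ENNReal.ofReal_le_ofReal ?_
    have hp : ∏ j, r (w j) = ∏ j ∈ Finset.range n, r (a j) := by
      rw [Finset.prod_range]
      exact Finset.prod_congr rfl fun j _ => by rw [ha j]
    rw [Real.dist_eq, digitSeries_sub_of_agree c hr0 hr1 n a b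
      fun j hj => (ha ⟨j, hj⟩).trans (hb ⟨j, hj⟩).symm, abs_mul, hp,
      abs_of_nonneg (Finset.prod_nonneg fun j _ => hr0 _)]
    refine mul_le_mul_of_nonneg_left ?_ (Finset.prod_nonneg fun j _ => hr0 _)
    refine (abs_sub _ _).trans ?_
    linarith [hD fun k => a (k + n), hD fun k => b (k + n)]
  have hprod : ∀ n (w : Fin n → ι), ∏ j, r (w j) ≤ ρ ^ n := fun n w => by
    simpa using Finset.prod_le_prod (s := Finset.univ) (fun j _ => hr0 (w j)) fun j _ => hρ (w j)
  have htend : Tendsto (fun n : ℕ => ENNReal.ofReal (ρ ^ n * (2 * D))) atTop (𝓝 0) := by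
    have := (tendsto_pow_atTop_nhds_zero_of_lt_one hρ0 hρ1).mul_const (2 * D)
    simpa using ENNReal.tendsto_ofReal this
  have hμ := Measure.hausdorffMeasure_le_liminf_sum (α : ℝ) (range (digitSeries c r)) _ htend t
    (Eventually.of_forall fun n w => (hdiam n w).trans <| ENNReal.ofReal_le_ofReal <|
      mul_le_mul_of_nonneg_right (hprod n w) (by positivity))
    (Eventually.of_forall fun n => by
      rintro _ ⟨a, rfl⟩
      exact mem_iUnion.2 ⟨fun j => a j, a, fun j => rfl, rfl⟩)
  -- Summed over words of length n, the products of `r i ^ α` give (∑ r_i^α)^n = 1, so the bound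
  -- does not depend on n.
  have hsum : ∀ n, ∑ w, Metric.ediam (t n w) ^ (α : ℝ) ≤ ENNReal.ofReal ((2 * D) ^ (α : ℝ)) := by
    intro n
    calc ∑ w, Metric.ediam (t n w) ^ (α : ℝ)
        ≤ ∑ w : Fin n → ι, ENNReal.ofReal ((∏ j, r (w j) ^ (α : ℝ)) * (2 * D) ^ (α : ℝ)) := by
          refine Finset.sum_le_sum fun w _ => ?_
          have h0 : 0 ≤ ∏ j, r (w j) := Finset.prod_nonneg fun j _ => hr0 _
          rw [Real.finsetProd_rpow _ _ fun j _ => hr0 _, ← Real.mul_rpow h0 (by positivity),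
            ← ENNReal.ofReal_rpow_of_nonneg (by positivity) α.coe_nonneg]
          exact ENNReal.rpow_le_rpow (hdiam n w) α.coe_nonneg
      _ = ENNReal.ofReal ((2 * D) ^ (α : ℝ)) := by
          rw [← ENNReal.ofReal_sum_of_nonneg fun w _ => mul_nonneg
            (Finset.prod_nonneg fun j _ => Real.rpow_nonneg (hr0 _) _)
            (Real.rpow_nonneg (by positivity) _), ← Finset.sum_mul,
            ← Fintype.sum_pow (fun i => r i ^ (α : ℝ)), hα, one_pow, one_mul]
  refine dimH_le_of_hausdorffMeasure_ne_top (ne_top_of_le_ne_top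
    (ENNReal.ofReal_ne_top (r := (2 * D) ^ (α : ℝ))) (hμ.trans ?_))
  exact (liminf_le_liminf (Eventually.of_forall hsum)).trans (by simp)

/-! ### Lower bound for the dimension. -/

/-- The last right endpoint is 1, so there is a least index whose right endpoint reaches `t`; its
left endpoint is 0 or the right endpoint of its predecessor, which fails to reach `t`. -/
theorem exists_partialSum_le [Fintype ι] [LinearOrder ι] {w : ι → ℝ}
    (hw : ∑ i, w i = 1) {t : ℝ} (ht : t ∈ Icc (0 : ℝ) 1) :
    ∃ i, ∑ j with j < i, w j ≤ t ∧ t ≤ (∑ j with j < i, w j) + w i := by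
  have hne : (Finset.univ : Finset ι).Nonempty := by
    rw [Finset.univ_nonempty_iff, ← not_isEmpty_iff]
    intro h
    simp at hw
  have hle : ∀ i, (∑ j with j < i, w j) + w i = ∑ j with j ≤ i, w j := fun i => by
    have : Finset.univ.filter (· ≤ i) = insert i (Finset.univ.filter (· < i)) := by
      ext j; simp [le_iff_eq_or_lt]
    rw [this, Finset.sum_insert (by simp), add_comm]
  let T : Finset ι := {i | t ≤ ∑ j with j ≤ i, w j}
  have hT : T.Nonempty := by
    refine ⟨Finset.univ.max' hne, ?_⟩
    simp only [T, Finset.mem_filter, Finset.mem_univ, true_and]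
    rw [Finset.filter_true_of_mem fun j _ => Finset.le_max' _ _ (Finset.mem_univ j), hw]
    exact ht.2
  refine ⟨T.min' hT, ?_, ?_⟩
  · rcases (Finset.univ.filter (· < T.min' hT)).eq_empty_or_nonempty with h | h
    · rw [h]; simpa using ht.1
    · set m := (Finset.univ.filter (· < T.min' hT)).max' h
      have hm : m < T.min' hT :=
        (Finset.mem_filter.1 ((Finset.univ.filter (· < T.min' hT)).max'_mem h)).2
      have hmT : m ∉ T := fun hmem => (T.min'_le m hmem).not_gt hm
      have : Finset.univ.filter (· < T.min' hT) = Finset.univ.filter (· ≤ m) := by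
        ext j
        simp only [Finset.mem_filter, Finset.mem_univ, true_and]
        exact ⟨fun hj => Finset.le_max' _ _ (by simpa using hj), fun hj => hj.trans_lt hm⟩
      rw [this]
      simpa [T] using (not_le.1 fun h => hmT (by simpa [T] using h)).le
  · rw [hle]
    simpa [T] using T.min'_mem hT

/-- Choosing a digit and rescaling the remainder to [0, 1] can be iterated forever; the remainders
are a bounded solution of the recursion. -/
theorem Icc_subset_range_digitSeries [Fintype ι] [LinearOrder ι] {w : ι → ℝ}
    (hw0 : ∀ i, 0 ≤ w i) (hw1 : ∀ i, w i < 1) (hpos : ∀ i, 0 < w i) (hw : ∑ i, w i = 1) :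
    Icc (0 : ℝ) 1 ⊆ range (digitSeries (fun i => ∑ j with j < i, w j) w) := by
  intro t ht
  have step : ∀ x : Icc (0 : ℝ) 1, ∃ i, ∃ y : Icc (0 : ℝ) 1,
      (x : ℝ) = (∑ j with j < i, w j) + w i * y := by
    rintro ⟨x, hx⟩
    obtain ⟨i, hi1, hi2⟩ := exists_partialSum_le hw hx
    refine ⟨i, ⟨(x - ∑ j with j < i, w j) / w i, ?_, ?_⟩, ?_⟩
    · exact div_nonneg (by linarith) (hw0 i)
    · rw [div_le_one (hpos i)]; linarith
    · have := (hpos i).ne'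
      field_simp
      ring
  choose dig nxt h using step
  let y : ℕ → Icc (0 : ℝ) 1 := fun n => nxt^[n] ⟨t, ht⟩
  refine ⟨fun n => dig (y n), ?_⟩
  refine (eq_digitSeries_of_recursion (y := fun n => (y n : ℝ)) (D := 1) _ hw0 hw1 _
    (fun n => abs_le.2 ⟨by linarith [(y n).2.1], (y n).2.2⟩) fun n => ?_).symm
  simp only [y, Function.iterate_succ_apply']
  exact h _

/-- If the cylinders of rank one are disjoint, then they are uniformly separated. -/
theorem exists_separation [Finite ι] (c : ι → ℝ) {r : ι → ℝ} (hr0 : ∀ i, 0 ≤ r i)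
    (hr1 : ∀ i, r i < 1)
    (hdisj : ∀ a b : ℕ → ι, a 0 ≠ b 0 → digitSeries c r a ≠ digitSeries c r b) :
    ∃ δ : ℝ, 0 < δ ∧ ∀ a b : ℕ → ι, a 0 ≠ b 0 → δ ≤ |digitSeries c r a - digitSeries c r b| := by
  -- With `ι` finite and discrete the address space is compact, so a positive continuous function on
  -- the closed set of pairs with different first entries is bounded away from 0.
  let _ : TopologicalSpace ι := ⊥
  have : DiscreteTopology ι := ⟨rfl⟩
  have hcont := continuous_digitSeries c hr0 hr1
  have hK : IsCompact {q : (ℕ → ι) × (ℕ → ι) | q.1 0 ≠ q.2 0} := by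
    refine IsClosed.isCompact ?_
    have : Continuous fun q : (ℕ → ι) × (ℕ → ι) => (q.1 0, q.2 0) := by fun_prop
    exact (isClosed_discrete {x : ι × ι | x.1 ≠ x.2}).preimage this
  obtain ⟨δ, h0, h⟩ := hK.exists_forall_le' (a := 0)
    (f := fun q => |digitSeries c r q.1 - digitSeries c r q.2|)
    (Continuous.continuousOn (by fun_prop))
    fun q hq => abs_pos.2 (sub_ne_zero.2 (hdisj q.1 q.2 hq))
  exact ⟨δ, h0, fun a b hab => h (a, b) hab⟩

/-- The map onto `[0, 1]` that preserves addresses is Hölder continuous, which bounds the dimension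
from below by the similarity dimension. -/
theorem le_dimH_range_digitSeries [Fintype ι] [LinearOrder ι] (c : ι → ℝ) {r : ι → ℝ}
    (hr0 : ∀ i, 0 < r i) (hr1 : ∀ i, r i < 1)
    (hdisj : ∀ a b : ℕ → ι, a 0 ≠ b 0 → digitSeries c r a ≠ digitSeries c r b)
    (α : ℝ≥0) (hα : ∑ i, r i ^ (α : ℝ) = 1) :
    (α : ℝ≥0∞) ≤ dimH (range (digitSeries c r)) := by
  rcases eq_or_ne α 0 with rfl | hα0
  · simp
  have hαpos : 0 < α := pos_iff_ne_zero.2 hα0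
  have hr0' : ∀ i, 0 ≤ r i := fun i => (hr0 i).le
  obtain ⟨δ, hδ0, hδ⟩ := exists_separation c hr0' hr1 hdisj
  set w : ι → ℝ := fun i => r i ^ (α : ℝ)
  have hwpos : ∀ i, 0 < w i := fun i => Real.rpow_pos_of_pos (hr0 i) _
  have hw1 : ∀ i, w i < 1 := fun i => Real.rpow_lt_one (hr0' i) (hr1 i) hαpos
  have hw0 : ∀ i, 0 ≤ w i := fun i => (hwpos i).le
  set q : ι → ℝ := fun i => ∑ j with j < i, w j
  have hqw : ∀ i, q i + w i ≤ 1 := fun i => by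
    rw [← hα, add_comm, ← Finset.sum_insert (f := w) (by simp)]
    exact Finset.sum_le_sum_of_subset_of_nonneg (Finset.subset_univ _) fun j _ _ => hw0 j
  have hmem := digitSeries_mem_Icc (c := q) hw0 hw1 (fun i => Finset.sum_nonneg fun j _ => hw0 j) hqw
  -- At the first disagreement the common prefix contributes the same factor to both sides. Of the
  -- tails, the left difference is at most 1, while the right one is at least δ.
  have hest : ∀ a b : ℕ → ι, |digitSeries q w a - digitSeries q w b|
      ≤ (|digitSeries c r a - digitSeries c r b| / δ) ^ (α : ℝ) := by
    intro a b
    by_cases hab : a = b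
    · subst hab
      simp [hα0]
    have hex : ∃ n, a n ≠ b n := Function.ne_iff.1 hab
    classical
    have hagree : ∀ j < Nat.find hex, a j = b j := fun j hj => not_not.1 (Nat.find_min hex hj)
    have hne := Nat.find_spec hex
    generalize Nat.find hex = n at hagree hne
    have hp : 0 ≤ ∏ j ∈ Finset.range n, r (a j) := Finset.prod_nonneg fun j _ => hr0' _
    rw [digitSeries_sub_of_agree q hw0 hw1 n a b hagree,
      digitSeries_sub_of_agree c hr0' hr1 n a b hagree,
      abs_mul, abs_mul, abs_of_nonneg hp, mul_div_assoc,
      Real.mul_rpow hp (div_nonneg (abs_nonneg _) hδ0.le),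
      Real.finsetProd_rpow _ _ fun j _ => hr0' _, abs_of_nonneg (Real.rpow_nonneg hp _)]
    refine mul_le_mul_of_nonneg_left ?_ (Real.rpow_nonneg hp _)
    have h1 := hmem fun k => a (k + n)
    have h2 := hmem fun k => b (k + n)
    refine (abs_le.2 ⟨by linarith [h1.1, h2.2], by linarith [h1.2, h2.1]⟩ : _ ≤ (1 : ℝ)).trans ?_
    refine Real.one_le_rpow ?_ α.coe_nonneg
    rw [one_le_div hδ0]
    exact hδ _ _ (by simpa using hne)
  set S := range (digitSeries c r)
  have : Nonempty ι := not_isEmpty_iff.1 fun _ => by simp at hα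
  have hS : ∀ x ∈ S, ∃ a, digitSeries c r a = x := fun x hx => hx
  choose! adr hadr using hS
  have hhol : HolderOnWith (Real.toNNReal ((1 / δ) ^ (α : ℝ))) α
      (fun x => digitSeries q w (adr x)) S := by
    intro x hx y hy
    have h := hest (adr x) (adr y)
    rw [hadr x hx, hadr y hy, div_eq_inv_mul, ← one_div, Real.mul_rpow (by positivity)
      (abs_nonneg _)] at h
    rw [edist_dist, edist_dist, ENNReal.ofReal_rpow_of_nonneg dist_nonneg α.coe_nonneg,
      ← ENNReal.ofReal_coe_nnreal, Real.coe_toNNReal _ (by positivity),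
      ← ENNReal.ofReal_mul (by positivity)]
    exact ENNReal.ofReal_le_ofReal h
  have himg : Icc (0 : ℝ) 1 ⊆ (fun x => digitSeries q w (adr x)) '' S := by
    refine (Icc_subset_range_digitSeries hw0 hw1 hwpos hα).trans ?_
    rintro _ ⟨a, rfl⟩
    refine ⟨_, ⟨a, rfl⟩, ?_⟩
    -- The chosen address may differ from `a`, but by `hest` two addresses of one point have the
    -- same image.
    have h := hest (adr (digitSeries c r a)) a
    rw [hadr _ ⟨a, rfl⟩] at h
    simpa [hα0, sub_eq_zero] using h
  have h1 : (1 : ℝ≥0∞) ≤ dimH S / α := by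
    refine le_trans ?_ ((dimH_mono himg).trans (hhol.dimH_image_le hαpos))
    rw [Real.dimH_of_nonempty_interior (by simp)]
    simp
  rwa [ENNReal.le_div_iff_mul_le (by simp [hα0]) (by simp), one_mul] at h1

end DigitSeries

/-! ### The block maps and the set as their attractor. -/

section BlockMaps

open Set

variable {s : ℕ} {p : Fin s → ℝ}

theorem pBeta_nonneg (hpos : ∀ i, 0 < p i) (k : Fin s) : 0 ≤ pBeta p k :=
  Finset.sum_nonneg fun i _ => (hpos i).le

theorem pBeta_add_le_pBeta (hpos : ∀ i, 0 < p i) {i j : Fin s} (hij : i < j) :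
    pBeta p i + p i ≤ pBeta p j := by
  unfold pBeta
  rw [add_comm, ← Finset.sum_insert (f := p) (by simp)]
  refine Finset.sum_le_sum_of_subset_of_nonneg (fun k hk => ?_) fun k _ _ => (hpos k).le
  rcases Finset.mem_insert.1 hk with rfl | hk
  · simpa using hij
  · exact Finset.mem_Iio.2 ((Finset.mem_Iio.1 hk).trans hij)

theorem pBeta_add_le_one (hpos : ∀ i, 0 < p i) (hsum : ∑ i, p i = 1) (k : Fin s) :
    pBeta p k + p k ≤ 1 := by
  unfold pBeta
  rw [add_comm, ← Finset.sum_insert (f := p) (by simp), ← hsum]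
  exact Finset.sum_le_sum_of_subset_of_nonneg (Finset.subset_univ _) fun k _ _ => (hpos k).le

theorem pBeta_pos (hpos : ∀ i, 0 < p i) {k : Fin s} (hk : (k : ℕ) ≠ 0) : 0 < pBeta p k := by
  refine Finset.sum_pos (fun i _ => hpos i) ⟨⟨0, by omega⟩, ?_⟩
  rw [Finset.mem_Iio, Fin.lt_def]
  exact Nat.pos_of_ne_zero hk

theorem weight_lt_one (hs : 2 < s) (hpos : ∀ i, 0 < p i) (hsum : ∑ i, p i = 1) (k : Fin s) :
    p k < 1 := by
  have : Nontrivial (Fin s) := Fin.nontrivial_iff_two_le.2 hs.le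
  obtain ⟨j, hj⟩ := exists_ne k
  rw [← hsum]
  exact Finset.single_lt_sum hj (Finset.mem_univ _) (Finset.mem_univ _) (hpos j)
    fun i _ _ => (hpos i).le

/-- Prepending the digit `k` to a P-representation. -/
noncomputable def digitMap (p : Fin s → ℝ) (k : Fin s) (x : ℝ) : ℝ := pBeta p k + p k * x

/-- Prepending the block `u … u i` of length `i` to a P-representation. -/
noncomputable def blockMap (p : Fin s → ℝ) (u i : Fin s) (x : ℝ) : ℝ :=
  (digitMap p u)^[(i : ℕ) - 1] (digitMap p i x)

/-- The interval is half-open because neighbouring images of [0, 1] share an endpoint, while those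
of (0, 1] do not. -/
theorem digitMap_mem_Ioc (hpos : ∀ i, 0 < p i) (hsum : ∑ i, p i = 1) (k : Fin s) :
    MapsTo (digitMap p k) (Ioc 0 1) (Ioc 0 1) := by
  intro x hx
  have h1 := pBeta_nonneg hpos k
  have h2 := pBeta_add_le_one hpos hsum k
  have h3 := mul_pos (hpos k) hx.1
  have h4 := mul_le_of_le_one_right (hpos k).le hx.2
  exact ⟨by unfold digitMap; linarith, by unfold digitMap; linarith⟩

theorem digitMap_mem_Ioc_of_ne_zero (hpos : ∀ i, 0 < p i) (hsum : ∑ i, p i = 1) {k : Fin s}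
    (hk : (k : ℕ) ≠ 0) {x : ℝ} (hx : x ∈ Icc (0 : ℝ) 1) : digitMap p k x ∈ Ioc (0 : ℝ) 1 := by
  have h1 := pBeta_pos hpos hk
  have h2 := pBeta_add_le_one hpos hsum k
  have h3 := mul_nonneg (hpos k).le hx.1
  have h4 := mul_le_of_le_one_right (hpos k).le hx.2
  exact ⟨by unfold digitMap; linarith, by unfold digitMap; linarith⟩

theorem digitMap_lt_digitMap (hpos : ∀ i, 0 < p i) {i j : Fin s} (hij : i < j) {x y : ℝ}
    (hx : x ∈ Ioc (0 : ℝ) 1) (hy : y ∈ Ioc (0 : ℝ) 1) : digitMap p i x < digitMap p j y := by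
  have h1 := pBeta_add_le_pBeta hpos hij
  have h3 := mul_pos (hpos j) hy.1
  have h4 := mul_le_of_le_one_right (hpos i).le hx.2
  unfold digitMap
  linarith

theorem digitMap_ne_digitMap (hpos : ∀ i, 0 < p i) {i j : Fin s} (hij : i ≠ j) {x y : ℝ}
    (hx : x ∈ Ioc (0 : ℝ) 1) (hy : y ∈ Ioc (0 : ℝ) 1) : digitMap p i x ≠ digitMap p j y := by
  rcases hij.lt_or_gt with h | h
  · exact (digitMap_lt_digitMap hpos h hx hy).ne
  · exact (digitMap_lt_digitMap hpos h hy hx).ne'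

theorem digitMap_injective (hpos : ∀ i, 0 < p i) (k : Fin s) :
    Function.Injective (digitMap p k) := fun x y h => by
  simpa [digitMap, (hpos k).ne'] using h

theorem iterate_digitMap (u : Fin s) (m : ℕ) (x : ℝ) :
    (digitMap p u)^[m] x = (digitMap p u)^[m] 0 + p u ^ m * x := by
  induction m with
  | zero => simp
  | succ m ih =>
    rw [Function.iterate_succ_apply', Function.iterate_succ_apply', ih]
    unfold digitMap
    ring

theorem blockMap_eq (u i : Fin s) (x : ℝ) :
    blockMap p u i x = blockMap p u i 0 + p i * p u ^ ((i : ℕ) - 1) * x := by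
  unfold blockMap
  rw [iterate_digitMap _ _ (digitMap p i x), iterate_digitMap _ _ (digitMap p i 0)]
  unfold digitMap
  ring

theorem blockMap_mem_Ioc (hpos : ∀ i, 0 < p i) (hsum : ∑ i, p i = 1) (u : Fin s) {i : Fin s}
    (hi : (i : ℕ) ≠ 0) {x : ℝ} (hx : x ∈ Icc (0 : ℝ) 1) : blockMap p u i x ∈ Ioc (0 : ℝ) 1 :=
  (digitMap_mem_Ioc hpos hsum u).iterate _ (digitMap_mem_Ioc_of_ne_zero hpos hsum hi hx)

theorem blockMap_ne_blockMap_of_lt (hpos : ∀ i, 0 < p i) (hsum : ∑ i, p i = 1) {u i j : Fin s}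
    (hi : (i : ℕ) ≠ 0) (hiu : i ≠ u) (hij : i < j) {x y : ℝ}
    (hx : x ∈ Ioc (0 : ℝ) 1) (hy : y ∈ Ioc (0 : ℝ) 1) : blockMap p u i x ≠ blockMap p u j y := by
  unfold blockMap
  -- Past the common i - 1 copies of `u`, the longer block still has m + 1 copies of `u` where the
  -- shorter one shows `i`.
  obtain ⟨m, hm⟩ : ∃ m, (j : ℕ) - 1 = ((i : ℕ) - 1) + (m + 1) :=
    ⟨(j : ℕ) - i - 1, by have := Fin.lt_def.1 hij; omega⟩
  rw [hm, Function.iterate_add_apply, Function.iterate_succ_apply']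
  intro h
  exact digitMap_ne_digitMap hpos hiu hx
    ((digitMap_mem_Ioc hpos hsum u).iterate m (digitMap_mem_Ioc hpos hsum j hy))
    ((digitMap_injective hpos u).iterate _ h)

theorem blockMap_ne_blockMap (hpos : ∀ i, 0 < p i) (hsum : ∑ i, p i = 1) {u i j : Fin s}
    (hi : i ∈ admissibleDigits u) (hj : j ∈ admissibleDigits u) (hij : i ≠ j) {x y : ℝ}
    (hx : x ∈ Ioc (0 : ℝ) 1) (hy : y ∈ Ioc (0 : ℝ) 1) : blockMap p u i x ≠ blockMap p u j y := by
  simp only [admissibleDigits, Finset.mem_filter, Finset.mem_univ, true_and] at hi hj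
  rcases hij.lt_or_gt with h | h
  · exact blockMap_ne_blockMap_of_lt hpos hsum hi.1 hi.2 h hx hy
  · exact (blockMap_ne_blockMap_of_lt hpos hsum hj.1 hj.2 h hy hx).symm

/-- The contraction ratio `p_i p_u ^ (i - 1)` of the block map of `i`. -/
noncomputable def blockRatio (p : Fin s → ℝ) (u : Fin s) (i : admissibleDigits u) : ℝ :=
  p (i : Fin s) * p u ^ (((i : Fin s) : ℕ) - 1)

/-- The translation part of the block map of `i`. -/
noncomputable def blockOffset (p : Fin s → ℝ) (u : Fin s) (i : admissibleDigits u) : ℝ :=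
  blockMap p u i 0

theorem blockRatio_pos (hpos : ∀ i, 0 < p i) (u : Fin s) (i : admissibleDigits u) :
    0 < blockRatio p u i := mul_pos (hpos _) (pow_pos (hpos _) _)

/-- Each ratio is at most `p i`, and the sum omits p_0 > 0. -/
theorem sum_blockRatio_lt_one (hs : 2 < s) (hpos : ∀ i, 0 < p i) (hsum : ∑ i, p i = 1)
    (u : Fin s) : ∑ i, blockRatio p u i < 1 := by
  calc ∑ i, blockRatio p u i
      ≤ ∑ i : admissibleDigits u, p i := Finset.sum_le_sum fun i _ =>
        mul_le_of_le_one_right (hpos _).le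
          (pow_le_one₀ (hpos u).le (weight_lt_one hs hpos hsum u).le)
    _ = ∑ i ∈ admissibleDigits u, p i := Finset.sum_coe_sort _ p
    _ < ∑ i, p i := Finset.sum_lt_sum_of_subset (Finset.subset_univ _)
        (Finset.mem_univ (⟨0, by omega⟩ : Fin s)) (by simp [admissibleDigits]) (hpos _)
        fun i _ _ => (hpos i).le
    _ = 1 := hsum

theorem blockRatio_lt_one (hs : 2 < s) (hpos : ∀ i, 0 < p i) (hsum : ∑ i, p i = 1)
    (u : Fin s) (i : admissibleDigits u) : blockRatio p u i < 1 :=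
  (Finset.single_le_sum (fun j _ => (blockRatio_pos hpos u j).le) (Finset.mem_univ i)).trans_lt
    (sum_blockRatio_lt_one hs hpos hsum u)

theorem digitSeries_block_mem_Ioc (hs : 2 < s) (hpos : ∀ i, 0 < p i) (hsum : ∑ i, p i = 1)
    (u : Fin s) (a : ℕ → admissibleDigits u) :
    digitSeries (blockOffset p u) (blockRatio p u) a ∈ Ioc (0 : ℝ) 1 := by
  have hr0 := fun i => (blockRatio_pos hpos u i).le
  have hr1 := blockRatio_lt_one hs hpos hsum u
  have hne : ∀ i : admissibleDigits u, ((i : Fin s) : ℕ) ≠ 0 :=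
    fun i => (Finset.mem_filter.1 i.2).2.1
  have h := digitSeries_mem_Icc hr0 hr1 (c := blockOffset p u)
    (fun i => (blockMap_mem_Ioc hpos hsum u (hne i) (by simp)).1.le)
    (fun i => by
      have := (blockMap_mem_Ioc hpos hsum u (hne i) (x := 1) (by simp)).2
      rw [blockMap_eq, mul_one] at this
      exact this)
  -- The bound in [0, 1] improves to (0, 1] by splitting off one block, whose last digit is nonzero.
  rw [digitSeries_eq _ hr0 hr1]
  have := blockMap_mem_Ioc hpos hsum u (hne (a 0)) (h fun n => a (n + 1))
  rwa [blockMap_eq] at this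

theorem digitSeries_block_ne (hs : 2 < s) (hpos : ∀ i, 0 < p i) (hsum : ∑ i, p i = 1)
    (u : Fin s) (a b : ℕ → admissibleDigits u) (hab : a 0 ≠ b 0) :
    digitSeries (blockOffset p u) (blockRatio p u) a
      ≠ digitSeries (blockOffset p u) (blockRatio p u) b := by
  have hr0 := fun i => (blockRatio_pos hpos u i).le
  have hr1 := blockRatio_lt_one hs hpos hsum u
  have h := blockMap_ne_blockMap hpos hsum (a 0).2 (b 0).2
    (fun h => hab (Subtype.ext h)) (digitSeries_block_mem_Ioc hs hpos hsum u fun n => a (n + 1))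
    (digitSeries_block_mem_Ioc hs hpos hsum u fun n => b (n + 1))
  rw [blockMap_eq, blockMap_eq u (b 0 : Fin s)] at h
  rwa [digitSeries_eq _ hr0 hr1 a, digitSeries_eq _ hr0 hr1 b]

theorem isPRepresentation_iff (hs : 2 < s) (hpos : ∀ i, 0 < p i) (hsum : ∑ i, p i = 1)
    (d : ℕ → Fin s) (x : ℝ) : IsPRepresentation p d x ↔ digitSeries (pBeta p) p d = x :=
  ⟨fun h => h.tsum_eq, fun h => h ▸ (summable_digitSeries (pBeta p) (fun i => (hpos i).le)
    (weight_lt_one hs hpos hsum) d).hasSum⟩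

theorem digitSeries_eq_iterate_digitMap (hs : 2 < s) (hpos : ∀ i, 0 < p i) (hsum : ∑ i, p i = 1)
    (u : Fin s) (m : ℕ) (d : ℕ → Fin s) (hd : ∀ j < m, d j = u) :
    digitSeries (pBeta p) p d = (digitMap p u)^[m] (digitSeries (pBeta p) p fun k => d (k + m)) := by
  induction m generalizing d with
  | zero => rfl
  | succ m ih =>
    rw [digitSeries_eq _ (fun i => (hpos i).le) (weight_lt_one hs hpos hsum), hd 0 m.succ_pos,
      Function.iterate_succ_apply', ih (fun k => d (k + 1)) fun j hj => hd (j + 1) (by omega)]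
    rfl

theorem digitSeries_eq_blockMap (hs : 2 < s) (hpos : ∀ i, 0 < p i) (hsum : ∑ i, p i = 1)
    (u i : Fin s) (hi : (i : ℕ) ≠ 0) (d : ℕ → Fin s) (hd : ∀ j < (i : ℕ) - 1, d j = u)
    (hdi : d ((i : ℕ) - 1) = i) :
    digitSeries (pBeta p) p d
      = blockMap p u i (digitSeries (pBeta p) p fun k => d (k + i)) := by
  rw [digitSeries_eq_iterate_digitMap hs hpos hsum u _ d hd,
    digitSeries_eq _ (fun i => (hpos i).le) (weight_lt_one hs hpos hsum), zero_add, hdi]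
  have h : ∀ k, k + 1 + ((i : ℕ) - 1) = k + i := fun k => by omega
  simp only [h]
  rfl

theorem blockStart_succ (a : ℕ → Fin s) (n : ℕ) : blockStart a (n + 1) = blockStart a n + a n :=
  Finset.sum_range_succ _ _

theorem exists_isBlockSequence (u : Fin s) (a : ℕ → Fin s) (ha : ∀ n, (a n : ℕ) ≠ 0) :
    ∃ d, IsBlockSequence u a d := by
  classical
  have hmono : StrictMono (blockStart a) := strictMono_nat_of_lt_succ fun n => by
    rw [blockStart_succ]
    have := ha n
    omega
  -- Position `k` ends block `n` exactly when block n + 1 starts at k + 1; every other position gets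
  -- `u`.
  refine ⟨fun k => if h : ∃ n, blockStart a (n + 1) = k + 1 then a h.choose else u, fun n => ?_⟩
  have hn := ha n
  have hsucc := blockStart_succ a n
  constructor
  · intro j hj
    refine dif_neg ?_
    rintro ⟨m, hm⟩
    have h1 := hmono.lt_iff_lt (a := n) (b := m + 1)
    have h2 := hmono.lt_iff_lt (a := m + 1) (b := n + 1)
    omega
  · have h : ∃ m, blockStart a (m + 1) = blockStart a n + ((a n : ℕ) - 1) + 1 := ⟨n, by omega⟩
    refine (dif_pos h).trans ?_
    have h2 : blockStart a (h.choose + 1) = blockStart a (n + 1) := by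
      rw [h.choose_spec]; omega
    rw [Nat.succ_injective (hmono.injective h2)]

/-- The tails of `d` at the block starts are a bounded solution of the recursion of the block
system. -/
theorem digitSeries_of_isBlockSequence (hs : 2 < s) (hpos : ∀ i, 0 < p i) (hsum : ∑ i, p i = 1)
    (u : Fin s) (a : ℕ → admissibleDigits u) (d : ℕ → Fin s)
    (hd : IsBlockSequence u (fun n => (a n : Fin s)) d) :
    digitSeries (pBeta p) p d = digitSeries (blockOffset p u) (blockRatio p u) a := by
  obtain ⟨D, -, hD⟩ := exists_abs_digitSeries_le (pBeta p) (fun i => (hpos i).le)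
    (weight_lt_one hs hpos hsum)
  have h := eq_digitSeries_of_recursion (blockOffset p u) (fun i => (blockRatio_pos hpos u i).le)
    (blockRatio_lt_one hs hpos hsum u) a (D := D)
    (y := fun n => digitSeries (pBeta p) p
      fun k => d (k + blockStart (fun n => (a n : Fin s)) n)) (fun n => hD _) fun n => ?_
  · simpa [blockStart] using h
  · obtain ⟨h1, h2⟩ := hd n
    refine (digitSeries_eq_blockMap hs hpos hsum u (a n) (Finset.mem_filter.1 (a n).2).2.1 _
      (fun j hj => by rw [add_comm]; exact h1 j hj) (by rw [add_comm]; exact h2)).trans ?_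
    rw [blockMap_eq, blockStart_succ]
    simp only [add_assoc, add_comm ((a n : Fin s) : ℕ)]
    rfl

theorem setS_eq_range (hs : 2 < s) (hpos : ∀ i, 0 < p i) (hsum : ∑ i, p i = 1) (u : Fin s) :
    setS p u = range (digitSeries (blockOffset p u) (blockRatio p u)) := by
  ext x
  constructor
  · rintro ⟨a, d, ha, hd, hx⟩
    rw [isPRepresentation_iff hs hpos hsum] at hx
    exact ⟨fun n => ⟨a n, ha n⟩,
      (digitSeries_of_isBlockSequence hs hpos hsum u (fun n => ⟨a n, ha n⟩) d hd).symm.trans hx⟩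
  · rintro ⟨a, rfl⟩
    obtain ⟨d, hd⟩ := exists_isBlockSequence u (fun n => (a n : Fin s))
      fun n => (Finset.mem_filter.1 (a n).2).2.1
    exact ⟨_, d, fun n => (a n).2, hd, (isPRepresentation_iff hs hpos hsum d _).2
      (digitSeries_of_isBlockSequence hs hpos hsum u a d hd)⟩

theorem admissibleDigits_nonempty (hs : 2 < s) (u : Fin s) : (admissibleDigits u).Nonempty := by
  by_cases h : (u : ℕ) = 1
  · exact ⟨⟨2, hs⟩, by simp [admissibleDigits, Fin.ext_iff, h]⟩
  · exact ⟨⟨1, by omega⟩, by simp [admissibleDigits, Fin.ext_iff, Ne.symm h]⟩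

/-- For s = 3 and u ∈ {1, 2} only one digit is admissible and the set is a single point. -/
theorem one_lt_card_admissibleDigits (hs : 2 < s) (u : Fin s) (h : s = 3 → (u : ℕ) = 0) :
    1 < (admissibleDigits u).card := by
  rw [Finset.one_lt_card]
  by_cases h1 : (u : ℕ) = 1
  · refine ⟨⟨2, hs⟩, ?_, ⟨3, by omega⟩, ?_, ?_⟩ <;> simp [admissibleDigits, Fin.ext_iff, h1]
  by_cases h2 : (u : ℕ) = 2
  · refine ⟨⟨1, by omega⟩, ?_, ⟨3, by omega⟩, ?_, ?_⟩ <;>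
      simp [admissibleDigits, Fin.ext_iff, h2]
  · refine ⟨⟨1, by omega⟩, ?_, ⟨2, hs⟩, ?_, ?_⟩ <;>
      simp [admissibleDigits, Fin.ext_iff, Ne.symm h1, Ne.symm h2]

theorem isSelfSimilarSet_setS (hs : 2 < s) (hpos : ∀ i, 0 < p i) (hsum : ∑ i, p i = 1)
    (u : Fin s) : IsSelfSimilarSet (blockRatio p u) (setS p u) := by
  have hr0 := fun i => (blockRatio_pos hpos u i).le
  have hr1 := blockRatio_lt_one hs hpos hsum u
  have : Nonempty (admissibleDigits u) := (admissibleDigits_nonempty hs u).to_subtype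
  rw [setS_eq_range hs hpos hsum]
  refine ⟨range_nonempty _, isCompact_range (continuous_digitSeries _ hr0 hr1),
    fun i => ⟨blockRatio_pos hpos u i, hr1 i⟩, fun i x => blockOffset p u i + blockRatio p u i * x,
    fun i x y => ?_, range_digitSeries_eq_iUnion _ hr0 hr1, fun i j hij => ?_⟩
  · rw [dist_add_left, Real.dist_eq, ← mul_sub, abs_mul, abs_of_nonneg (hr0 i), Real.dist_eq]
  · refine Set.disjoint_left.2 ?_
    rintro _ ⟨_, ⟨a, rfl⟩, rfl⟩ ⟨_, ⟨b, rfl⟩, h⟩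
    -- Prepending `i` and `j` to the addresses turns a common point of two pieces into equal series
    -- with different first entries.
    have := digitSeries_block_ne hs hpos hsum u (fun n => Nat.casesOn n i a)
      (fun n => Nat.casesOn n j b) hij
    rw [digitSeries_eq _ hr0 hr1, digitSeries_eq _ hr0 hr1 fun n => Nat.casesOn n j b] at this
    exact this h.symm

end BlockMaps

/-! ### The equation for the dimension, and total disconnectedness. -/

section SimilarityDimension

variable {ι : Type*} [Fintype ι]

theorem strictAnti_sum_rpow [Nonempty ι] {r : ι → ℝ} (hr0 : ∀ i, 0 < r i) (hr1 : ∀ i, r i < 1) :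
    StrictAnti fun t : ℝ => ∑ i, r i ^ t := fun _ _ hxy =>
  Finset.sum_lt_sum_of_nonempty Finset.univ_nonempty fun i _ =>
    Real.rpow_lt_rpow_of_exponent_gt (hr0 i) (hr1 i) hxy

/-- Intermediate values: the sum is the number of indices, hence at least 1, at exponent 0, and is
below 1 at exponent 1. -/
theorem exists_similarityDimension [Nonempty ι] {r : ι → ℝ} (hr0 : ∀ i, 0 < r i)
    (hr : ∑ i, r i < 1) : ∃ α : ℝ, 0 ≤ α ∧ α < 1 ∧ ∑ i, r i ^ α = 1 := by
  have hcont : Continuous fun t : ℝ => ∑ i, r i ^ t :=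
    continuous_finsetSum _ fun i _ => Real.continuous_const_rpow (hr0 i).ne'
  obtain ⟨α, hα, h⟩ := intermediate_value_Icc' zero_le_one hcont.continuousOn
    (show (1 : ℝ) ∈ Set.Icc _ _ from ⟨by simpa using hr.le, by
      simpa using Nat.one_le_iff_ne_zero.2 (Fintype.card_ne_zero (α := ι))⟩)
  refine ⟨α, hα.1, hα.2.lt_of_ne ?_, h⟩
  rintro rfl
  simp only [Real.rpow_one] at h
  exact hr.ne h

/-- A connected subset with two points contains an interval, which has dimension 1. -/
theorem isTotallyDisconnected_of_dimH_lt_one {S : Set ℝ} (h : dimH S < 1) :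
    IsTotallyDisconnected S := by
  refine fun t hts ht x hx y hy => ?_
  by_contra hne
  wlog hxy : x < y generalizing x y
  · exact this y hy x hx (Ne.symm hne) (lt_of_le_of_ne (not_lt.1 hxy) (Ne.symm hne))
  have hsub : Set.Icc x y ⊆ S := (ht.Icc_subset hx hy).trans hts
  have h1 : dimH (Set.Icc x y) = 1 := by
    rw [Real.dimH_of_nonempty_interior (by simpa using hxy)]
    simp
  exact (h1 ▸ dimH_mono hsub).not_gt h

end SimilarityDimension

theorem mainTheorem1 (s : ℕ) (hs : 2 < s) (p : Fin s → ℝ) (hpos : ∀ i, 0 < p i)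
    (hsum : ∑ i, p i = 1) (u : Fin s) :
    IsSelfSimilarSet
        (fun i : admissibleDigits u => p (i : Fin s) * p u ^ (((i : Fin s) : ℕ) - 1))
        (setS p u) ∧
    ((s = 3 → (u : ℕ) = 0) → IsFractalSubset (setS p u)) ∧
    ∃ α₀ : ℝ, 0 ≤ α₀ ∧ dimH (setS p u) = ENNReal.ofReal α₀ ∧
      ∑ i ∈ admissibleDigits u, (p i * p u ^ ((i : ℕ) - 1)) ^ α₀ = 1 ∧
      ∀ t : ℝ, ∑ i ∈ admissibleDigits u, (p i * p u ^ ((i : ℕ) - 1)) ^ t = 1 → t = α₀ := by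
  have hr0 := blockRatio_pos hpos u
  have hr1 := blockRatio_lt_one hs hpos hsum u
  have : Nonempty (admissibleDigits u) := (admissibleDigits_nonempty hs u).to_subtype
  obtain ⟨α, hα0, hα1, hα⟩ := exists_similarityDimension hr0 (sum_blockRatio_lt_one hs hpos hsum u)
  have hdim : dimH (setS p u) = ENNReal.ofReal α := by
    lift α to NNReal using hα0
    rw [setS_eq_range hs hpos hsum, ENNReal.ofReal_coe_nnreal]
    exact (dimH_range_digitSeries_le _ (fun i => (hr0 i).le) hr1 α hα).antisymm
      (le_dimH_range_digitSeries _ hr0 hr1 (digitSeries_block_ne hs hpos hsum u) α hα)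
  have hcoe : ∀ t : ℝ, ∑ i ∈ admissibleDigits u, (p i * p u ^ ((i : ℕ) - 1)) ^ t
      = ∑ i, blockRatio p u i ^ t := fun t =>
    (Finset.sum_coe_sort (admissibleDigits u) fun i => (p i * p u ^ ((i : ℕ) - 1)) ^ t).symm
  refine ⟨isSelfSimilarSet_setS hs hpos hsum u, fun h3 => ⟨?_, ?_⟩, α, hα0, hdim, ?_, ?_⟩
  · refine isTotallyDisconnected_of_dimH_lt_one ?_
    rw [hdim]
    simpa using hα1
  · rw [hdim, ENNReal.ofReal_pos]
    refine hα0.lt_of_ne' ?_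
    -- At exponent 0 the equation says that there is exactly one admissible digit.
    rintro rfl
    have hcard := one_lt_card_admissibleDigits hs u h3
    simp only [Real.rpow_zero, Finset.sum_const, Finset.card_univ, Fintype.card_coe, nsmul_eq_mul,
      mul_one, Nat.cast_eq_one] at hα
    omega
  · rw [hcoe, hα]
  · intro t ht
    rw [hcoe, ← hα] at ht
    exact (strictAnti_sum_rpow hr0 hr1).injective ht
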